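/- **The calculus.** Terms are given by $$a ::= x \mid (a\ a') \mid \lambda x.a \mid 0 \mid (S\,a) \mid (R_{\mathrm{nat}}\,a\,a'\,a'') \mid \mathrm{nil} \mid (\mathrm{cons}\,a\,a') \mid (R_{\mathrm{vec}}\,a\,a'\,a'') \mid \mathrm{join}$$ and types by $$\phi ::= \mathrm{nat} \mid \langle \mathrm{vec}\ \phi\ a\rangle \mid \Pi x{:}\phi.\phi' \mid \forall x{:}\phi.\phi' \mid a = a',$$ both up to renaming of bound variables. One-step reduction $\leadsto$ is the closure under arbitrary term contexts (including under $\lambda$) of $$(\lambda x.a)\,a' \leadsto [a'/x]a,\quad (R_{\mathrm{nat}}\,a\,a'\,0)\leadsto a,\quad (R_{\mathrm{nat}}\,a\,a'\,(S\,a''))\leadsto (a'\,a''\,(R_{\mathrm{nat}}\,a\,a'\,a'')),$$ $$(R_{\mathrm{vec}}\,a\,a'\,\mathrm{nil})\leadsto a,\quad (R_{\mathrm{vec}}\,a\,a'\,(\mathrm{cons}\,a_1\,a''))\leadsto (a'\,a_1\,a''\,(R_{\mathrm{vec}}\,a\,a'\,a'')).$$ Write $a\downarrow a'$ (joinable) if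 there is $\hat a$ with $a\leadsto^*\hat a$ and $a'\leadsto^*\hat a$. A context is a finite list $\Gamma$ of declarations $x:\phi$ of distinct variables, and $\Gamma\ \mathit{Ok}$ means that the free variables of each declared type are declared earlier in $\Gamma$. The judgment $\Gamma\vdash a:\phi$ is the least relation closed under the following rules. - var: $\Gamma\vdash x:\Gamma(x)$ if $x\in\mathrm{dom}(\Gamma)$ and $\Gamma\ \mathit{Ok}$. - join: $\Gamma\vdash \mathrm{join}:a=a'$ if $a\downarrow a'$ and $\Gamma\ \mathit{Ok}$. - conv: if $\Gamma\vdash p:b=b'$ and $\Gamma\vdash a:[b/x]\phi$ with $x\notin\mathrm{dom}(\Gamma)$, then $\Gamma\vdash a:[b'/x]\phi$. - spec-abs: if $\Gamma,x{:}\phi'\vdash a:\phi$ and $x$ is not free in $a$, then $\Gamma\vdash a:\forall x{:}\phi'.\phi$. - spec-app: if $\Gamma\vdash a:\forall x{:}\phi'.\phi$ and $\Gamma\vdash a':\phi'$, then $\Gamma\vdash a:[a'/x]\phi$. - abs: if $\Gamma,x{:}\phi'\vdash a:\phi$, then $\Gamma\vdash\lambda x.a:\Pi x{:}\phi'.\phi$.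 - app: if $\Gamma\vdash a:\Pi x{:}\phi'.\phi$ and $\Gamma\vdash a':\phi'$, then $\Gamma\vdash (a\ a'):[a'/x]\phi$. - zero, nil: if $\Gamma\ \mathit{Ok}$, then $\Gamma\vdash 0:\mathrm{nat}$ and $\Gamma\vdash\mathrm{nil}:\langle\mathrm{vec}\ \phi\ 0\rangle$ for every type $\phi$. - succ: if $\Gamma\vdash a:\mathrm{nat}$, then $\Gamma\vdash (S\,a):\mathrm{nat}$. - cons: if $\Gamma\vdash a:\phi$ and $\Gamma\vdash a':\langle\mathrm{vec}\ \phi\ l\rangle$, then $\Gamma\vdash(\mathrm{cons}\,a\,a'):\langle\mathrm{vec}\ \phi\ (S\,l)\rangle$. - Rnat: if $x\notin\mathrm{dom}(\Gamma)$, $\Gamma\vdash a'':\mathrm{nat}$, $\Gamma\vdash a:[0/x]\phi$ and $\Gamma\vdash a':\Pi y{:}\mathrm{nat}.\,\Pi u{:}[y/x]\phi.\,[(S\,y)/x]\phi$, then $\Gamma\vdash(R_{\mathrm{nat}}\,a\,a'\,a''):[a''/x]\phi$. - Rvec: if $x,y\notin\mathrm{dom}(\Gamma)$, $\Gamma\vdash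 a'':\langle\mathrm{vec}\ \phi'\ l\rangle$, $\Gamma\vdash a:[0/y,\mathrm{nil}/x]\phi$ and $\Gamma\vdash a':\Pi z{:}\phi'.\,\forall k{:}\mathrm{nat}.\,\Pi v{:}\langle\mathrm{vec}\ \phi'\ k\rangle.\,\Pi u{:}[k/y,v/x]\phi.\,[(S\,k)/y,(\mathrm{cons}\,z\,v)/x]\phi$, then $\Gamma\vdash(R_{\mathrm{vec}}\,a\,a'\,a''):[l/y,a''/x]\phi$. **Theorem.** If $\Gamma\vdash a:\phi$ and $\Gamma\vdash a':\phi'$, then it is decidable whether $a\downarrow a'$. Precisely: there is an algorithm (a partial computable function on pairs of Gödel numbers of terms) which, on every input $(a,a')$ for which there exist $\Gamma$, $\phi$, $\phi'$ with $\Gamma\vdash a:\phi$ and $\Gamma\vdash a':\phi'$, halts and answers correctly whether $a\downarrow a'$. -/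

import Mathlib

namespace Tvec

/-- Unannotated terms, up to renaming of bound variables (de Bruijn indices: `lam` binds index `0`
of its body). -/
inductive Term : Type
  | var (n : ℕ)
  | app (a b : Term)
  | lam (a : Term)
  | zero
  | succ (a : Term)
  | recNat (a b c : Term)
  | nil
  | cons (a b : Term)
  | recVec (a b c : Term)
  | join

/-- Types, up to renaming of bound variables. In `pi A B` and `all A B` the index `0` of `B` is
bound. -/
inductive Ty : Type
  | nat
  | vec (A : Ty) (l : Term)
  | pi (A B : Ty)
  | all (A B : Ty)
  | eq (a b : Term)

/-- Lift a renaming of variables under one binder. -/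
def upRen (r : ℕ → ℕ) : ℕ → ℕ
  | 0 => 0
  | n + 1 => r n + 1

/-- Rename the free variables of a term. -/
def Term.rename : (ℕ → ℕ) → Term → Term
  | r, .var n => .var (r n)
  | r, .app a b => .app (a.rename r) (b.rename r)
  | r, .lam a => .lam (a.rename (upRen r))
  | _, .zero => .zero
  | r, .succ a => .succ (a.rename r)
  | r, .recNat a b c => .recNat (a.rename r) (b.rename r) (c.rename r)
  | _, .nil => .nil
  | r, .cons a b => .cons (a.rename r) (b.rename r)
  | r, .recVec a b c => .recVec (a.rename r) (b.rename r) (c.rename r)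
  | _, .join => .join

/-- Lift a simultaneous substitution under one binder. -/
def upSubst (s : ℕ → Term) : ℕ → Term
  | 0 => .var 0
  | n + 1 => (s n).rename Nat.succ

/-- Capture-avoiding simultaneous substitution in a term. -/
def Term.subst : (ℕ → Term) → Term → Term
  | s, .var n => s n
  | s, .app a b => .app (a.subst s) (b.subst s)
  | s, .lam a => .lam (a.subst (upSubst s))
  | _, .zero => .zero
  | s, .succ a => .succ (a.subst s)
  | s, .recNat a b c => .recNat (a.subst s) (b.subst s) (c.subst s)
  | _, .nil => .nil
  | s, .cons a b => .cons (a.subst s) (b.subst s)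
  | s, .recVec a b c => .recVec (a.subst s) (b.subst s) (c.subst s)
  | _, .join => .join

/-- Rename the free variables of a type. -/
def Ty.rename : (ℕ → ℕ) → Ty → Ty
  | _, .nat => .nat
  | r, .vec A l => .vec (A.rename r) (l.rename r)
  | r, .pi A B => .pi (A.rename r) (B.rename (upRen r))
  | r, .all A B => .all (A.rename r) (B.rename (upRen r))
  | r, .eq a b => .eq (a.rename r) (b.rename r)

/-- Capture-avoiding simultaneous substitution in a type. -/
def Ty.subst : (ℕ → Term) → Ty → Ty
  | _, .nat => .nat
  | s, .vec A l => .vec (A.subst s) (l.subst s)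
  | s, .pi A B => .pi (A.subst s) (B.subst (upSubst s))
  | s, .all A B => .all (A.subst s) (B.subst (upSubst s))
  | s, .eq a b => .eq (a.subst s) (b.subst s)

/-- The substitution `[a/0]` that removes the variable `0` from the scope. -/
def inst (a : Term) : ℕ → Term
  | 0 => a
  | n + 1 => .var n

/-- The simultaneous substitution `[a/0, l/1]` that removes the variables `0` and `1` from the
scope. -/
def inst₂ (a l : Term) : ℕ → Term
  | 0 => a
  | 1 => l
  | n + 2 => .var n

/-- One-step reduction: the closure of the contraction rules under arbitrary contexts. -/
inductive Step : Term → Term → Prop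
  | beta (a b : Term) : Step (.app (.lam a) b) (a.subst (inst b))
  | recNat_zero (a b : Term) : Step (.recNat a b .zero) a
  | recNat_succ (a b c : Term) :
      Step (.recNat a b (.succ c)) (.app (.app b c) (.recNat a b c))
  | recVec_nil (a b : Term) : Step (.recVec a b .nil) a
  | recVec_cons (a b d c : Term) :
      Step (.recVec a b (.cons d c)) (.app (.app (.app b d) c) (.recVec a b c))
  | app_left {a a' : Term} (b : Term) : Step a a' → Step (.app a b) (.app a' b)
  | app_right (a : Term) {b b' : Term} : Step b b' → Step (.app a b) (.app a b')
  | lam {a a' : Term} : Step a a' → Step (.lam a) (.lam a')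
  | succ {a a' : Term} : Step a a' → Step (.succ a) (.succ a')
  | recNat₁ {a a' : Term} (b c : Term) : Step a a' → Step (.recNat a b c) (.recNat a' b c)
  | recNat₂ (a : Term) {b b' : Term} (c : Term) :
      Step b b' → Step (.recNat a b c) (.recNat a b' c)
  | recNat₃ (a b : Term) {c c' : Term} : Step c c' → Step (.recNat a b c) (.recNat a b c')
  | cons_left {a a' : Term} (b : Term) : Step a a' → Step (.cons a b) (.cons a' b)
  | cons_right (a : Term) {b b' : Term} : Step b b' → Step (.cons a b) (.cons a b')
  | recVec₁ {a a' : Term} (b c : Term) : Step a a' → Step (.recVec a b c) (.recVec a' b c)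
  | recVec₂ (a : Term) {b b' : Term} (c : Term) :
      Step b b' → Step (.recVec a b c) (.recVec a b' c)
  | recVec₃ (a b : Term) {c c' : Term} : Step c c' → Step (.recVec a b c) (.recVec a b c')

/-- `a ↓ a'`: the terms `a` and `a'` have a common reduct. -/
def Joinable (a a' : Term) : Prop :=
  ∃ c : Term, Relation.ReflTransGen Step a c ∧ Relation.ReflTransGen Step a' c

/-- All free variables of the term are among the `k` innermost ones. -/
def Term.Scoped : ℕ → Term → Prop
  | k, .var n => n < k
  | k, .app a b => a.Scoped k ∧ b.Scoped k
  | k, .lam a => a.Scoped (k + 1)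
  | _, .zero => True
  | k, .succ a => a.Scoped k
  | k, .recNat a b c => a.Scoped k ∧ b.Scoped k ∧ c.Scoped k
  | _, .nil => True
  | k, .cons a b => a.Scoped k ∧ b.Scoped k
  | k, .recVec a b c => a.Scoped k ∧ b.Scoped k ∧ c.Scoped k
  | _, .join => True

/-- All free variables of the type are among the `k` innermost ones. -/
def Ty.Scoped : ℕ → Ty → Prop
  | _, .nat => True
  | k, .vec A l => A.Scoped k ∧ l.Scoped k
  | k, .pi A B => A.Scoped k ∧ B.Scoped (k + 1)
  | k, .all A B => A.Scoped k ∧ B.Scoped (k + 1)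
  | k, .eq a b => a.Scoped k ∧ b.Scoped k

/-- Typing contexts, innermost variable first: the entry at position `n` is the type of the
variable `n`, and lives in the scope of the entries that follow it in the list. -/
abbrev Ctx : Type := List Ty

/-- `Γ Ok`: the free variables of each declared type are declared earlier. -/
def Ctx.Ok : Ctx → Prop
  | [] => True
  | A :: Γ => A.Scoped Γ.length ∧ Ctx.Ok Γ

/-- For a type `A` with designated variable `x` (index `0`): the type `[S y / x] A` in the scope
extended by `y` and then `u` (so `y` has index `1`). -/
def recNatResult (A : Ty) : Ty :=
  A.subst fun
    | 0 => .succ (.var 1)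
    | n + 1 => .var (n + 2)

/-- The type `Π y : nat. Π u : [y/x]A. [S y/x]A` of the step function of `recNat`. -/
def recNatStepTy (A : Ty) : Ty :=
  .pi .nat (.pi A (recNatResult A))

/-- For a type `A` with designated variables `x` (index `0`, the vector) and `y` (index `1`, its
length) and a type `E` of elements: the type
`Π z : E. ∀ l : nat. Π v : ⟨vec E l⟩. Π u : [l/y, v/x]A. [S l/y, cons z v/x]A`
of the step function of `recVec`. -/
def recVecStepTy (E A : Ty) : Ty :=
  .pi E <| .all .nat <| .pi (.vec (E.rename (· + 2)) (.var 0)) <|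
    .pi
      (A.subst fun
        | 0 => .var 0
        | 1 => .var 1
        | n + 2 => .var (n + 3))
      (A.subst fun
        | 0 => .cons (.var 3) (.var 1)
        | 1 => .succ (.var 2)
        | n + 2 => .var (n + 4))

/-- Type assignment `Γ ⊢ a : A`. -/
inductive HasType : Ctx → Term → Ty → Prop
  | var {Γ : Ctx} {n : ℕ} {A : Ty} :
      Γ[n]? = some A → Γ.Ok → HasType Γ (.var n) (A.rename (· + (n + 1)))
  | join {Γ : Ctx} {a a' : Term} :
      Joinable a a' → Γ.Ok → HasType Γ .join (.eq a a')
  | conv {Γ : Ctx} {a p b b' : Term} {A : Ty} :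
      HasType Γ p (.eq b b') → HasType Γ a (A.subst (inst b)) →
      HasType Γ a (A.subst (inst b'))
  /- The bound variable does not occur in the term: in the extended context the term is the
  weakening of `a`. -/
  | specAbs {Γ : Ctx} {a : Term} {A B : Ty} :
      HasType (A :: Γ) (a.rename Nat.succ) B → HasType Γ a (.all A B)
  | specApp {Γ : Ctx} {a b : Term} {A B : Ty} :
      HasType Γ a (.all A B) → HasType Γ b A → HasType Γ a (B.subst (inst b))
  | abs {Γ : Ctx} {a : Term} {A B : Ty} :
      HasType (A :: Γ) a B → HasType Γ (.lam a) (.pi A B)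
  | app {Γ : Ctx} {a b : Term} {A B : Ty} :
      HasType Γ a (.pi A B) → HasType Γ b A → HasType Γ (.app a b) (B.subst (inst b))
  | zero {Γ : Ctx} : Γ.Ok → HasType Γ .zero .nat
  | nil {Γ : Ctx} {A : Ty} : Γ.Ok → HasType Γ .nil (.vec A .zero)
  | succ {Γ : Ctx} {a : Term} : HasType Γ a .nat → HasType Γ (.succ a) .nat
  | recNat {Γ : Ctx} {a b c : Term} {A : Ty} :
      HasType Γ c .nat → HasType Γ a (A.subst (inst .zero)) →
      HasType Γ b (recNatStepTy A) →
      HasType Γ (.recNat a b c) (A.subst (inst c))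
  | cons {Γ : Ctx} {a b l : Term} {A : Ty} :
      HasType Γ a A → HasType Γ b (.vec A l) → HasType Γ (.cons a b) (.vec A (.succ l))
  | recVec {Γ : Ctx} {a b c l : Term} {E A : Ty} :
      HasType Γ c (.vec E l) → HasType Γ a (A.subst (inst₂ .nil .zero)) →
      HasType Γ b (recVecStepTy E A) →
      HasType Γ (.recVec a b c) (A.subst (inst₂ c l))

/-- The Gödel number of a term. -/
def Term.code : Term → ℕ
  | .var n => Nat.pair 0 n
  | .app a b => Nat.pair 1 (Nat.pair a.code b.code)
  | .lam a => Nat.pair 2 a.code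
  | .zero => Nat.pair 3 0
  | .succ a => Nat.pair 4 a.code
  | .recNat a b c => Nat.pair 5 (Nat.pair a.code (Nat.pair b.code c.code))
  | .nil => Nat.pair 6 0
  | .cons a b => Nat.pair 7 (Nat.pair a.code b.code)
  | .recVec a b c => Nat.pair 8 (Nat.pair a.code (Nat.pair b.code c.code))
  | .join => Nat.pair 9 0

/-- Distinct terms have distinct Gödel numbers. -/
theorem Term.code_injective : Function.Injective Term.code := by
  intro a
  induction a <;> intro b h <;> cases b <;> simp_all [Term.code, Nat.pair_eq_pair] <;> grind

end Tvec

namespace Tvec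

-- Every typable term has a normal form, and a deterministic strategy finds it; two such terms are
-- joinable exactly when their normal forms coincide.
--
-- Normalization is proved by reducibility (`HasType.red`). Equality hypotheses may be false, but
-- conversion only exchanges terms inside types. Reducibility is therefore defined on the simply
-- typed skeleton: the terms in a type are ignored and `all A B` is read as `B`. Conversion and
-- specialization then preserve reducibility at once (`red_subst`), in inconsistent contexts too.
-- Since variables are reducible, the identity substitution yields `HasType.normalizing`, even for
-- open terms.
--
-- Only weak normalization is obtained, and it suffices. By the triangle property of parallel
-- reduction (`Par.dev`), iterated complete development is cofinal (`Steps.exists_iterate_dev`),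
-- hence reaches any existing normal form. The same cofinality gives uniqueness of normal forms and
-- `joinable_iff_eq`. A fixed point of `Term.dev` need not be normal (Ω is one), but it is when met
-- on the orbit of a normalizing term (`Normalizing.nf_of_isFixedPt`).
--
-- Complete development is primitive recursive on Gödel numbers (`primrec_devCode`, `devCode_code`),
-- so an unbounded search for a stage at which both orbits are stationary, followed by an equality
-- test, is the algorithm.

-- Algebra of renaming and substitution.

@[simp] theorem upRen_succ_comp (r : ℕ → ℕ) : upRen r ∘ Nat.succ = Nat.succ ∘ r := rfl

theorem upRen_comp (r r' : ℕ → ℕ) : upRen r' ∘ upRen r = upRen (r' ∘ r) := by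
  funext n; cases n <;> rfl

theorem Term.rename_rename (a : Term) : ∀ r r' : ℕ → ℕ,
    (a.rename r).rename r' = a.rename (r' ∘ r) := by
  induction a <;> intro r r' <;> simp_all [Term.rename, upRen_comp]

theorem upSubst_comp_upRen (r : ℕ → ℕ) (s : ℕ → Term) :
    upSubst s ∘ upRen r = upSubst (s ∘ r) := by
  funext n; cases n <;> rfl

theorem Term.subst_rename_left (a : Term) : ∀ (r : ℕ → ℕ) (s : ℕ → Term),
    (a.rename r).subst s = a.subst (s ∘ r) := by
  induction a <;> intro r s <;> simp_all [Term.rename, Term.subst, upSubst_comp_upRen]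

theorem rename_upRen_upSubst (s : ℕ → Term) (r : ℕ → ℕ) :
    (fun n => (upSubst s n).rename (upRen r)) = upSubst (fun n => (s n).rename r) := by
  funext n
  cases n with
  | zero => rfl
  | succ n => simp only [upSubst, Term.rename_rename, upRen_succ_comp]

theorem Term.rename_subst (a : Term) : ∀ (s : ℕ → Term) (r : ℕ → ℕ),
    (a.subst s).rename r = a.subst (fun n => (s n).rename r) := by
  induction a <;> intro s r <;> simp_all [Term.rename, Term.subst, rename_upRen_upSubst]

theorem subst_upSubst_upSubst (s s' : ℕ → Term) :
    (fun n => (upSubst s n).subst (upSubst s')) = upSubst (fun n => (s n).subst s') := by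
  funext n
  cases n with
  | zero => rfl
  | succ n =>
    simp only [upSubst, Term.subst_rename_left, Term.rename_subst]
    rfl

theorem Term.subst_subst (a : Term) : ∀ s s' : ℕ → Term,
    (a.subst s).subst s' = a.subst (fun n => (s n).subst s') := by
  induction a <;> intro s s' <;> simp_all [Term.subst, subst_upSubst_upSubst]

theorem upSubst_var : upSubst Term.var = Term.var := by
  funext n; cases n <;> rfl

@[simp] theorem Term.subst_var (a : Term) : a.subst Term.var = a := by
  induction a <;> simp_all [Term.subst, upSubst_var]

theorem upRen_id : upRen id = id := by
  funext n; cases n <;> rfl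

@[simp] theorem Term.rename_id (a : Term) : a.rename id = a := by
  induction a <;> simp_all [Term.rename, upRen_id]

/-- Both sides are the same simultaneous substitution. This is what makes parallel β-steps stable
under substitution. -/
theorem Term.subst_inst_subst (a b : Term) (s : ℕ → Term) :
    (a.subst (inst b)).subst s = (a.subst (upSubst s)).subst (inst (b.subst s)) := by
  simp only [Term.subst_subst]
  congr 1
  funext n
  cases n with
  | zero => rfl
  | succ n =>
    simp only [upSubst, Term.subst_rename_left]
    exact (Term.subst_var _).symm

theorem Term.subst_inst_rename (a b : Term) (r : ℕ → ℕ) :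
    (a.subst (inst b)).rename r = (a.rename (upRen r)).subst (inst (b.rename r)) := by
  simp only [Term.subst_rename_left, Term.rename_subst]
  congr 1
  funext n
  cases n <;> rfl

-- Many-step reduction and its congruences.

/-- The reflexive transitive closure of one-step reduction. -/
abbrev Steps : Term → Term → Prop := Relation.ReflTransGen Step

namespace Steps

theorem app {a a' b b' : Term} (ha : Steps a a') (hb : Steps b b') :
    Steps (.app a b) (.app a' b') :=
  (ha.lift (Term.app · b) fun _ _ h => .app_left b h).trans
    (hb.lift (Term.app a' ·) fun _ _ h => .app_right a' h)

theorem lam {a a' : Term} (ha : Steps a a') : Steps (.lam a) (.lam a') :=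
  ha.lift Term.lam fun _ _ h => .lam h

theorem succ {a a' : Term} (ha : Steps a a') : Steps (.succ a) (.succ a') :=
  ha.lift Term.succ fun _ _ h => .succ h

theorem cons {a a' b b' : Term} (ha : Steps a a') (hb : Steps b b') :
    Steps (.cons a b) (.cons a' b') :=
  (ha.lift (Term.cons · b) fun _ _ h => .cons_left b h).trans
    (hb.lift (Term.cons a' ·) fun _ _ h => .cons_right a' h)

theorem recNat {a a' b b' c c' : Term} (ha : Steps a a') (hb : Steps b b') (hc : Steps c c') :
    Steps (.recNat a b c) (.recNat a' b' c') :=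
  (ha.lift (Term.recNat · b c) fun _ _ h => .recNat₁ b c h).trans <|
    (hb.lift (Term.recNat a' · c) fun _ _ h => .recNat₂ a' c h).trans
      (hc.lift (Term.recNat a' b' ·) fun _ _ h => .recNat₃ a' b' h)

theorem recVec {a a' b b' c c' : Term} (ha : Steps a a') (hb : Steps b b') (hc : Steps c c') :
    Steps (.recVec a b c) (.recVec a' b' c') :=
  (ha.lift (Term.recVec · b c) fun _ _ h => .recVec₁ b c h).trans <|
    (hb.lift (Term.recVec a' · c) fun _ _ h => .recVec₂ a' c h).trans
      (hc.lift (Term.recVec a' b' ·) fun _ _ h => .recVec₃ a' b' h)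

end Steps

theorem Step.rename {a b : Term} (h : Step a b) : ∀ r : ℕ → ℕ, Step (a.rename r) (b.rename r) := by
  induction h with
  | beta a b =>
    intro r
    rw [Term.subst_inst_rename]
    exact .beta _ _
  | _ => intro r; simp only [Term.rename]; constructor <;> simp_all

theorem Steps.rename {a b : Term} (h : Steps a b) (r : ℕ → ℕ) :
    Steps (a.rename r) (b.rename r) :=
  h.lift (Term.rename r) fun _ _ h => h.rename r

-- Parallel reduction and complete developments.

/-- Parallel reduction. -/
inductive Par : Term → Term → Prop
  | var (n : ℕ) : Par (.var n) (.var n)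
  | zero : Par .zero .zero
  | nil : Par .nil .nil
  | join : Par .join .join
  | lam {a a' : Term} : Par a a' → Par (.lam a) (.lam a')
  | succ {a a' : Term} : Par a a' → Par (.succ a) (.succ a')
  | app {a a' b b' : Term} : Par a a' → Par b b' → Par (.app a b) (.app a' b')
  | cons {a a' b b' : Term} : Par a a' → Par b b' → Par (.cons a b) (.cons a' b')
  | recNat {a a' b b' c c' : Term} :
      Par a a' → Par b b' → Par c c' → Par (.recNat a b c) (.recNat a' b' c')
  | recVec {a a' b b' c c' : Term} :
      Par a a' → Par b b' → Par c c' → Par (.recVec a b c) (.recVec a' b' c')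
  | beta {a a' b b' : Term} : Par a a' → Par b b' → Par (.app (.lam a) b) (a'.subst (inst b'))
  | recNat_zero {a a' : Term} (b : Term) : Par a a' → Par (.recNat a b .zero) a'
  | recNat_succ {a a' b b' c c' : Term} : Par a a' → Par b b' → Par c c' →
      Par (.recNat a b (.succ c)) (.app (.app b' c') (.recNat a' b' c'))
  | recVec_nil {a a' : Term} (b : Term) : Par a a' → Par (.recVec a b .nil) a'
  | recVec_cons {a a' b b' c c' d d' : Term} : Par a a' → Par b b' → Par c c' → Par d d' →
      Par (.recVec a b (.cons d c)) (.app (.app (.app b' d') c') (.recVec a' b' c'))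

theorem Par.refl (a : Term) : Par a a := by
  induction a <;> constructor <;> assumption

theorem Step.par {a b : Term} (h : Step a b) : Par a b := by
  induction h <;> constructor <;> first | assumption | exact Par.refl _

theorem Par.steps {a b : Term} (h : Par a b) : Steps a b := by
  induction h with
  | var | zero | nil | join => exact .refl
  | lam _ ih => exact ih.lam
  | succ _ ih => exact ih.succ
  | app _ _ iha ihb => exact iha.app ihb
  | cons _ _ iha ihb => exact iha.cons ihb
  | recNat _ _ _ iha ihb ihc => exact iha.recNat ihb ihc
  | recVec _ _ _ iha ihb ihc => exact iha.recVec ihb ihc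
  | beta _ _ iha ihb => exact (iha.lam.app ihb).tail (.beta _ _)
  | recNat_zero b _ ih => exact .head (.recNat_zero _ _) ih
  | recNat_succ _ _ _ iha ihb ihc => exact (iha.recNat ihb ihc.succ).tail (.recNat_succ _ _ _)
  | recVec_nil b _ ih => exact .head (.recVec_nil _ _) ih
  | recVec_cons _ _ _ _ iha ihb ihc ihd =>
    exact (iha.recVec ihb (ihd.cons ihc)).tail (.recVec_cons _ _ _ _)

theorem Par.rename {a b : Term} (h : Par a b) : ∀ r : ℕ → ℕ, Par (a.rename r) (b.rename r) := by
  induction h with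
  | beta _ _ iha ihb =>
    intro r
    rw [Term.subst_inst_rename]
    exact .beta (iha _) (ihb r)
  | _ => intro r; simp only [Term.rename]; constructor <;> simp_all

theorem Par.upSubst {s s' : ℕ → Term} (h : ∀ n, Par (s n) (s' n)) (n : ℕ) :
    Par (upSubst s n) (Tvec.upSubst s' n) := by
  cases n with
  | zero => exact .var 0
  | succ n => exact (h n).rename _

theorem Par.subst {a b : Term} (h : Par a b) : ∀ {s s' : ℕ → Term}, (∀ n, Par (s n) (s' n)) →
    Par (a.subst s) (b.subst s') := by
  induction h with
  | var n => exact fun hs => hs n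
  | beta _ _ iha ihb =>
    intro s s' hs
    rw [Term.subst_inst_subst]
    exact .beta (iha (Par.upSubst hs)) (ihb hs)
  | lam _ ih => exact fun hs => .lam (ih (Par.upSubst hs))
  | _ => intro s s' hs; simp only [Term.subst]; constructor <;> simp_all

theorem Par.inst {a a' b b' : Term} (ha : Par a a') (hb : Par b b') :
    Par (a.subst (inst b)) (a'.subst (Tvec.inst b')) :=
  ha.subst fun n => by
    cases n with
    | zero => exact hb
    | succ n => exact .var n

/-- The complete development of a term: all its redexes are contracted simultaneously. -/
def Term.dev : Term → Term
  | .var n => .var n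
  | .app (.lam a) b => a.dev.subst (inst b.dev)
  | .app a b => .app a.dev b.dev
  | .lam a => .lam a.dev
  | .zero => .zero
  | .succ a => .succ a.dev
  | .recNat a _ .zero => a.dev
  | .recNat a b (.succ c) => .app (.app b.dev c.dev) (.recNat a.dev b.dev c.dev)
  | .recNat a b c => .recNat a.dev b.dev c.dev
  | .nil => .nil
  | .cons a b => .cons a.dev b.dev
  | .recVec a _ .nil => a.dev
  | .recVec a b (.cons d c) => .app (.app (.app b.dev d.dev) c.dev) (.recVec a.dev b.dev c.dev)
  | .recVec a b c => .recVec a.dev b.dev c.dev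
  | .join => .join

/-- Takahashi's triangle property: a parallel step contracts some of the redexes present, and
contracting what remains of the others leads to the complete development. -/
theorem Par.dev {a b : Term} (h : Par a b) : Par b a.dev := by
  induction h with
  | var | zero | nil | join => constructor
  | lam _ ih => exact .lam ih
  | succ _ ih => exact .succ ih
  | cons _ _ iha ihb => exact .cons iha ihb
  | beta _ _ iha ihb => exact iha.inst ihb
  | recNat_zero _ _ ih => exact ih
  | recVec_nil _ _ ih => exact ih
  | recNat_succ _ _ _ iha ihb ihc => exact .app (.app ihb ihc) (.recNat iha ihb ihc)
  | recVec_cons _ _ _ _ iha ihb ihc ihd =>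
    exact .app (.app (.app ihb ihd) ihc) (.recVec iha ihb ihc)
  | @app a a' b b' ha hb iha ihb =>
    -- If the function is an abstraction, `Term.dev` contracts the outer redex that this step left
    -- alone. Inverting the induction hypothesis strips the `lam` and exposes the bodies.
    cases ha
    case lam =>
      cases iha with
      | lam iha => exact .beta iha ihb
    all_goals exact .app iha ihb
  | @recNat a a' b b' c c' ha hb hc iha ihb ihc =>
    cases hc
    case zero => exact .recNat_zero _ iha
    case succ =>
      cases ihc with
      | succ ihc => exact .recNat_succ iha ihb ihc
    all_goals exact .recNat iha ihb ihc
  | @recVec a a' b b' c c' ha hb hc iha ihb ihc =>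
    cases hc
    case nil => exact .recVec_nil _ iha
    case cons =>
      cases ihc with
      | cons ihd ihc => exact .recVec_cons iha ihb ihc ihd
    all_goals exact .recVec iha ihb ihc

theorem Term.steps_dev (a : Term) : Steps a a.dev :=
  (Par.refl a).dev.steps

theorem Term.steps_iterate_dev (a : Term) (k : ℕ) : Steps a (Term.dev^[k] a) := by
  induction k with
  | zero => exact .refl
  | succ k ih =>
    rw [Function.iterate_succ_apply']
    exact ih.trans (Term.steps_dev _)

theorem Par.iterate_dev {a b : Term} (h : Par a b) (k : ℕ) :
    Par (Term.dev^[k] a) (Term.dev^[k] b) := by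
  induction k with
  | zero => exact h
  | succ k ih =>
    simp only [Function.iterate_succ_apply']
    -- Applying the triangle property twice shows that `Term.dev` is monotone for `Par`.
    exact ih.dev.dev

/-- Iterated complete development is a cofinal reduction strategy. -/
theorem Steps.exists_iterate_dev {a b : Term} (h : Steps a b) :
    ∃ k, Steps b (Term.dev^[k] a) := by
  induction h using Relation.ReflTransGen.head_induction_on with
  | refl => exact ⟨0, .refl⟩
  | head h _ ih =>
    obtain ⟨k, hk⟩ := ih
    -- The first step is absorbed by one development: its target reduces in parallel to `a.dev`, and
    -- this persists through `k` further developments.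
    exact ⟨k + 1, hk.trans (h.par.dev.iterate_dev k).steps⟩

-- Normal forms.

mutual

/-- Neutral normal terms: a variable under eliminations. -/
inductive Ne : Term → Prop
  | var (n : ℕ) : Ne (.var n)
  | app {a b : Term} : Ne a → Nf b → Ne (.app a b)
  | recNat {a b c : Term} : Nf a → Nf b → Ne c → Ne (.recNat a b c)
  | recVec {a b c : Term} : Nf a → Nf b → Ne c → Ne (.recVec a b c)

/-- Normal terms in which only neutral terms are eliminated. -/
inductive Nf : Term → Prop
  | ne {a : Term} : Ne a → Nf a
  | lam {a : Term} : Nf a → Nf (.lam a)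
  | zero : Nf .zero
  | succ {a : Term} : Nf a → Nf (.succ a)
  | nil : Nf .nil
  | cons {a b : Term} : Nf a → Nf b → Nf (.cons a b)
  | join : Nf .join

end

mutual

theorem Ne.rename : ∀ {a : Term}, Ne a → ∀ r : ℕ → ℕ, Ne (a.rename r)
  | _, .var _, _ => .var _
  | _, .app ha hb, r => .app (ha.rename r) (hb.rename r)
  | _, .recNat ha hb hc, r => .recNat (ha.rename r) (hb.rename r) (hc.rename r)
  | _, .recVec ha hb hc, r => .recVec (ha.rename r) (hb.rename r) (hc.rename r)

theorem Nf.rename : ∀ {a : Term}, Nf a → ∀ r : ℕ → ℕ, Nf (a.rename r)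
  | _, .ne h, r => .ne (h.rename r)
  | _, .lam h, _ => .lam (h.rename _)
  | _, .zero, _ => .zero
  | _, .succ h, r => .succ (h.rename r)
  | _, .nil, _ => .nil
  | _, .cons ha hb, r => .cons (ha.rename r) (hb.rename r)
  | _, .join, _ => .join

end

mutual

theorem Ne.not_step {a b : Term} (h : Ne a) (hs : Step a b) : False := by
  cases h with
  | var n => cases hs
  | app ha hb =>
    cases hs with
    | beta => cases ha
    | app_left _ hs => exact ha.not_step hs
    | app_right _ hs => exact hb.not_step hs
  | recNat ha hb hc =>
    cases hs with
    | recNat_zero => cases hc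
    | recNat_succ => cases hc
    | recNat₁ _ _ hs => exact ha.not_step hs
    | recNat₂ _ _ hs => exact hb.not_step hs
    | recNat₃ _ _ hs => exact hc.not_step hs
  | recVec ha hb hc =>
    cases hs with
    | recVec_nil => cases hc
    | recVec_cons => cases hc
    | recVec₁ _ _ hs => exact ha.not_step hs
    | recVec₂ _ _ hs => exact hb.not_step hs
    | recVec₃ _ _ hs => exact hc.not_step hs

theorem Nf.not_step {a b : Term} (h : Nf a) (hs : Step a b) : False := by
  cases h with
  | ne h => exact h.not_step hs
  | lam h => cases hs with | lam hs => exact h.not_step hs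
  | zero => cases hs
  | succ h => cases hs with | succ hs => exact h.not_step hs
  | nil => cases hs
  | cons ha hb =>
    cases hs with
    | cons_left _ hs => exact ha.not_step hs
    | cons_right _ hs => exact hb.not_step hs
  | join => cases hs

end

theorem Nf.eq_of_steps {a b : Term} (h : Nf a) (hs : Steps a b) : b = a := by
  cases hs using Relation.ReflTransGen.head_induction_on with
  | refl => rfl
  | head hs _ => exact (h.not_step hs).elim

/-- The term reduces to a normal form. -/
def Normalizing (a : Term) : Prop := ∃ b, Steps a b ∧ Nf b

theorem Normalizing.rename {a : Term} (h : Normalizing a) (r : ℕ → ℕ) :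
    Normalizing (a.rename r) :=
  let ⟨_, hs, hb⟩ := h
  ⟨_, hs.rename r, hb.rename r⟩

theorem Normalizing.expand {a b : Term} (hs : Steps a b) (h : Normalizing b) : Normalizing a :=
  let ⟨_, hs', hc⟩ := h
  ⟨_, hs.trans hs', hc⟩

-- Reducibility and normalization of typable terms.

/-- Terms that evaluate to a neutral term or to a numeral with a neutral or zero core. -/
inductive RedNat : Term → Prop
  | ne {a b : Term} : Steps a b → Ne b → RedNat a
  | zero {a : Term} : Steps a .zero → RedNat a
  | succ {a b : Term} : Steps a (.succ b) → RedNat b → RedNat a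

/-- Terms that evaluate to a list of elements of `P` with a neutral or empty tail. -/
inductive RedVec (P : Term → Prop) : Term → Prop
  | ne {a b : Term} : Steps a b → Ne b → RedVec P a
  | nil {a : Term} : Steps a .nil → RedVec P a
  | cons {a b c : Term} : Steps a (.cons b c) → P b → RedVec P c → RedVec P a

/-- The Kripke function space of two predicates. -/
def RedFun (P Q : Term → Prop) (a : Term) : Prop :=
  Normalizing a ∧ ∀ (r : ℕ → ℕ) (b : Term), P b → Q (.app (a.rename r) b)

/-- Reducibility at a type. It does not depend on the terms inside the type. -/
def Red : Ty → Term → Prop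
  | .nat => RedNat
  | .vec A _ => RedVec (Red A)
  | .pi A B => RedFun (Red A) (Red B)
  | .all _ B => Red B
  | .eq _ _ => Normalizing

/-- The closure properties shared by all reducibility predicates. -/
structure Saturated (P : Term → Prop) : Prop where
  normalizing : ∀ {a : Term}, P a → Normalizing a
  ne : ∀ {a : Term}, Ne a → P a
  expand : ∀ {a b : Term}, Steps a b → P b → P a
  rename : ∀ {a : Term} (r : ℕ → ℕ), P a → P (a.rename r)

theorem saturated_normalizing : Saturated Normalizing where
  normalizing := id
  ne h := ⟨_, .refl, .ne h⟩
  expand := Normalizing.expand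
  rename r h := h.rename r

theorem saturated_redNat : Saturated RedNat where
  normalizing h := by
    induction h with
    | ne hs h => exact ⟨_, hs, .ne h⟩
    | zero hs => exact ⟨_, hs, .zero⟩
    | succ hs _ ih =>
      obtain ⟨c, hc, h⟩ := ih
      exact ⟨_, hs.trans hc.succ, .succ h⟩
  ne h := .ne .refl h
  expand hs h := by
    cases h with
    | ne hs' h => exact .ne (hs.trans hs') h
    | zero hs' => exact .zero (hs.trans hs')
    | succ hs' h => exact .succ (hs.trans hs') h
  rename r h := by
    induction h with
    | ne hs h => exact .ne (hs.rename r) (h.rename r)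
    | zero hs => exact .zero (hs.rename r)
    | succ hs _ ih => exact .succ (hs.rename r) ih

theorem Saturated.redVec {P : Term → Prop} (hP : Saturated P) : Saturated (RedVec P) where
  normalizing h := by
    induction h with
    | ne hs h => exact ⟨_, hs, .ne h⟩
    | nil hs => exact ⟨_, hs, .nil⟩
    | cons hs hb _ ih =>
      obtain ⟨d, hd, h⟩ := ih
      obtain ⟨b', hb', h'⟩ := hP.normalizing hb
      exact ⟨_, hs.trans (hb'.cons hd), .cons h' h⟩
  ne h := .ne .refl h
  expand hs h := by
    cases h with
    | ne hs' h => exact .ne (hs.trans hs') h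
    | nil hs' => exact .nil (hs.trans hs')
    | cons hs' hb h => exact .cons (hs.trans hs') hb h
  rename r h := by
    induction h with
    | ne hs h => exact .ne (hs.rename r) (h.rename r)
    | nil hs => exact .nil (hs.rename r)
    | cons hs hb _ ih => exact .cons (hs.rename r) (hP.rename r hb) ih

/-- Closure under renaming comes from the quantification over renamings in `RedFun`, because
renamings compose. -/
theorem Saturated.redFun {P Q : Term → Prop} (hP : Saturated P) (hQ : Saturated Q) :
    Saturated (RedFun P Q) where
  normalizing h := h.1
  ne h := by
    refine ⟨⟨_, .refl, .ne h⟩, fun r b hb => ?_⟩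
    obtain ⟨b', hs, hb'⟩ := hP.normalizing hb
    -- A neutral application needs a normal argument, so the argument is normalized first. Expansion
    -- along arbitrary reductions is harmless because only weak normalization is claimed.
    exact hQ.expand (Steps.app .refl hs) (hQ.ne (.app (h.rename r) hb'))
  expand hs h :=
    ⟨h.1.expand hs, fun r b hb => hQ.expand ((hs.rename r).app .refl) (h.2 r b hb)⟩
  rename r h := by
    refine ⟨h.1.rename r, fun r' b hb => ?_⟩
    rw [Term.rename_rename]
    exact h.2 _ b hb

theorem saturated_red : ∀ A : Ty, Saturated (Red A)
  | .nat => saturated_redNat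
  | .vec A _ => (saturated_red A).redVec
  | .pi A B => (saturated_red A).redFun (saturated_red B)
  | .all _ B => saturated_red B
  | .eq _ _ => saturated_normalizing

@[simp] theorem red_subst (A : Ty) : ∀ s : ℕ → Term, Red (A.subst s) = Red A := by
  induction A <;> intro s <;> simp_all [Red, Ty.subst]

@[simp] theorem red_rename (A : Ty) : ∀ r : ℕ → ℕ, Red (A.rename r) = Red A := by
  induction A <;> intro s <;> simp_all [Red, Ty.rename]

theorem RedFun.app {P Q : Term → Prop} {a b : Term} (h : RedFun P Q a) (hb : P b) :
    Q (.app a b) := by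
  simpa using h.2 id b hb

/-- Induction on the evaluation of the scrutinee: a neutral core leaves a neutral recursor once the
branches are normalized, and each constructor fires a contraction. -/
theorem RedNat.recNat {P : Term → Prop} (hP : Saturated P) {a b c : Term} (hc : RedNat c)
    (ha : P a) (hb : RedFun RedNat (RedFun P P) b) : P (.recNat a b c) := by
  induction hc with
  | ne hs h =>
    obtain ⟨a', hsa, ha'⟩ := hP.normalizing ha
    obtain ⟨b', hsb, hb'⟩ := hb.1
    exact hP.expand (hsa.recNat hsb hs) (hP.ne (.recNat ha' hb' h))
  | zero hs => exact hP.expand ((Steps.recNat .refl .refl hs).tail (.recNat_zero _ _)) ha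
  | succ hs h ih =>
    exact hP.expand ((Steps.recNat .refl .refl hs).tail (.recNat_succ _ _ _)) ((hb.app h).app ih)

theorem RedVec.recVec {P Q : Term → Prop} (hP : Saturated P) {a b c : Term} (hc : RedVec Q c)
    (ha : P a) (hb : RedFun Q (RedFun (RedVec Q) (RedFun P P)) b) : P (.recVec a b c) := by
  induction hc with
  | ne hs h =>
    obtain ⟨a', hsa, ha'⟩ := hP.normalizing ha
    obtain ⟨b', hsb, hb'⟩ := hb.1
    exact hP.expand (hsa.recVec hsb hs) (hP.ne (.recVec ha' hb' h))
  | nil hs => exact hP.expand ((Steps.recVec .refl .refl hs).tail (.recVec_nil _ _)) ha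
  | cons hs hd h ih =>
    exact hP.expand ((Steps.recVec .refl .refl hs).tail (.recVec_cons _ _ _ _))
      (((hb.app hd).app h).app ih)

/-- The substitution replaces the variables of the context by reducible terms. -/
def RedSubst (Γ : Ctx) (s : ℕ → Term) : Prop :=
  ∀ (n : ℕ) (A : Ty), Γ[n]? = some A → Red A (s n)

theorem redSubst_var (Γ : Ctx) : RedSubst Γ Term.var :=
  fun n A _ => (saturated_red A).ne (.var n)

/-- Extend a substitution by a term for the innermost variable. -/
def consSubst (a : Term) (s : ℕ → Term) : ℕ → Term
  | 0 => a
  | n + 1 => s n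

theorem RedSubst.cons {Γ : Ctx} {s : ℕ → Term} (h : RedSubst Γ s) {A : Ty} {a : Term}
    (ha : Red A a) : RedSubst (A :: Γ) (consSubst a s) := by
  intro n B hn
  cases n with
  | zero =>
    obtain rfl : A = B := by simpa using hn
    exact ha
  | succ n => exact h n B (by simpa using hn)

theorem RedSubst.rename {Γ : Ctx} {s : ℕ → Term} (h : RedSubst Γ s) (r : ℕ → ℕ) :
    RedSubst Γ (fun n => (s n).rename r) :=
  fun n A hn => (saturated_red A).rename r (h n A hn)

theorem upSubst_eq_consSubst (s : ℕ → Term) :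
    upSubst s = consSubst (.var 0) (fun n => (s n).rename Nat.succ) := by
  funext n; cases n <;> rfl

theorem Term.rename_eq_subst (a : Term) (r : ℕ → ℕ) : a.rename r = a.subst (Term.var ∘ r) := by
  rw [← Term.subst_rename_left, Term.subst_var]

/-- The contractum of a renamed abstraction applied to an argument is again an instance of the body,
to which the induction hypothesis of the fundamental lemma applies. -/
theorem Term.subst_upSubst_rename_inst (a b : Term) (s : ℕ → Term) (r : ℕ → ℕ) :
    ((a.subst (upSubst s)).rename (upRen r)).subst (inst b) =
      a.subst (consSubst b (fun n => (s n).rename r)) := by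
  simp only [Term.rename_subst, Term.subst_subst, rename_upRen_upSubst]
  congr 1
  funext n
  cases n with
  | zero => rfl
  | succ n =>
    rw [consSubst, Term.rename_eq_subst]
    simp only [upSubst, Term.subst_rename_left]
    rfl

/-- The fundamental lemma of the reducibility argument. -/
theorem HasType.red {Γ : Ctx} {a : Term} {A : Ty} (h : HasType Γ a A) :
    ∀ s : ℕ → Term, RedSubst Γ s → Red A (a.subst s) := by
  induction h with
  | var hn _ => intro s hs; simpa using! hs _ _ hn
  | join => exact fun s _ => ⟨.join, .refl, .join⟩
  | conv _ _ _ ih => intro s hs; simpa using ih s hs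
  | @specAbs _ a A _ _ ih =>
    intro s hs
    have := ih _ (hs.cons ((saturated_red A).ne (.var 0)))
    -- The value chosen for the quantified variable is irrelevant: the weakened term does not
    -- mention it.
    rwa [Term.subst_rename_left] at this
  | specApp _ _ iha _ => intro s hs; simpa using! iha s hs
  | @abs _ a A B _ ih =>
    intro s hs
    refine ⟨?_, fun r b hb => (saturated_red B).expand (.single (.beta _ _)) ?_⟩
    -- Normalizing under the binder means instantiating the bound variable by itself, with the rest
    -- of the substitution weakened.
    · have := ih _ ((hs.rename Nat.succ).cons ((saturated_red A).ne (.var 0)))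
      rw [← upSubst_eq_consSubst] at this
      obtain ⟨b, hb, hn⟩ := (saturated_red B).normalizing this
      exact ⟨_, hb.lam, .lam hn⟩
    · rw [Term.subst_upSubst_rename_inst]
      exact ih _ ((hs.rename r).cons hb)
  | app _ _ iha ihb => intro s hs; simpa using! (iha s hs).app (ihb s hs)
  | zero => exact fun s _ => .zero .refl
  | nil => exact fun s _ => .nil .refl
  | succ _ ih => exact fun s hs => .succ .refl (ih s hs)
  | @recNat _ a b c A _ _ _ ihc iha ihb =>
    intro s hs
    rw [red_subst]
    refine RedNat.recNat (saturated_red A) (ihc s hs) (by simpa using iha s hs) ?_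
    simpa [recNatStepTy, recNatResult, Red] using ihb s hs
  | cons _ _ iha ihb => exact fun s hs => .cons .refl (iha s hs) (ihb s hs)
  | @recVec _ a b c l E A _ _ _ ihc iha ihb =>
    intro s hs
    rw [red_subst]
    refine RedVec.recVec (saturated_red A) (ihc s hs) (by simpa using iha s hs) ?_
    simpa [recVecStepTy, Red] using ihb s hs

theorem HasType.normalizing {Γ : Ctx} {a : Term} {A : Ty} (h : HasType Γ a A) :
    Normalizing a := by
  simpa using (saturated_red A).normalizing (h.red _ (redSubst_var Γ))

-- Reaching and comparing normal forms by iterated development.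

theorem Nf.iterate_dev {a : Term} (h : Nf a) (k : ℕ) : Term.dev^[k] a = a :=
  h.eq_of_steps (a.steps_iterate_dev k)

theorem Steps.exists_iterate_dev_eq {a n : Term} (h : Steps a n) (hn : Nf n) :
    ∃ k, Term.dev^[k] a = n :=
  let ⟨k, hk⟩ := h.exists_iterate_dev
  ⟨k, hn.eq_of_steps hk⟩

/-- Any term at which the iteration of complete developments stops is the normal form. -/
theorem Normalizing.nf_of_isFixedPt {a : Term} (h : Normalizing a) {k : ℕ}
    (hk : Function.IsFixedPt Term.dev (Term.dev^[k] a)) : Nf (Term.dev^[k] a) := by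
  obtain ⟨n, hs, hn⟩ := h
  obtain ⟨j, rfl⟩ := hs.exists_iterate_dev_eq hn
  -- The `j + k`-th iterate is computed in both orders: from stage `k` it stays at the fixed point,
  -- from stage `j` at the normal form.
  have h₁ := hk.iterate j
  have h₂ := hn.iterate_dev k
  rw [Function.IsFixedPt, ← Function.iterate_add_apply, add_comm,
    Function.iterate_add_apply] at h₁
  rw [← h₁, h₂]
  exact hn

theorem joinable_iff_eq {a b n m : Term} (ha : Steps a n) (hn : Nf n) (hb : Steps b m)
    (hm : Nf m) : Joinable a b ↔ n = m := by
  constructor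
  · rintro ⟨c, hac, hbc⟩
    -- Any reduct `c` of `a` still reduces to `n`: cofinality takes `c` to some iterate of `a`, and
    -- `j` further developments pass beyond the normal form, where the orbit is constant.
    have key {a n : Term} (ha : Steps a n) (hn : Nf n) (hac : Steps a c) : Steps c n := by
      obtain ⟨j, rfl⟩ := ha.exists_iterate_dev_eq hn
      obtain ⟨i, hi⟩ := hac.exists_iterate_dev
      have h := hn.iterate_dev i
      rw [← Function.iterate_add_apply, add_comm, Function.iterate_add_apply] at h
      rw [← h]
      exact hi.trans (Term.steps_iterate_dev _ j)
    obtain ⟨j, hj⟩ := (key ha hn hac).exists_iterate_dev_eq hn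
    obtain ⟨i, hi⟩ := (key hb hm hbc).exists_iterate_dev_eq hm
    rw [← hn.iterate_dev i, ← hm.iterate_dev j, ← hj, ← hi, ← Function.iterate_add_apply,
      ← Function.iterate_add_apply, add_comm]
  · rintro rfl
    exact ⟨n, ha, hb⟩

-- Substitution as a primitive recursive function on codes.

/-- Replace every variable `n` under `k` binders by the term `v k n`. -/
def Term.mapVars (v : ℕ → ℕ → Term) : ℕ → Term → Term
  | k, .var n => v k n
  | k, .app a b => .app (a.mapVars v k) (b.mapVars v k)
  | k, .lam a => .lam (a.mapVars v (k + 1))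
  | _, .zero => .zero
  | k, .succ a => .succ (a.mapVars v k)
  | k, .recNat a b c => .recNat (a.mapVars v k) (b.mapVars v k) (c.mapVars v k)
  | _, .nil => .nil
  | k, .cons a b => .cons (a.mapVars v k) (b.mapVars v k)
  | k, .recVec a b c => .recVec (a.mapVars v k) (b.mapVars v k) (c.mapVars v k)
  | _, .join => .join

/-- When lifting a substitution under a binder amounts to raising an index, the recursion carries a
number instead of a function and can be coded. -/
theorem Term.subst_eq_mapVars {s : ℕ → ℕ → Term} (hs : ∀ k, upSubst (s k) = s (k + 1))
    (a : Term) : ∀ k, a.subst (s k) = a.mapVars s k := by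
  induction a <;> intro k <;> simp_all [Term.subst, Term.mapVars]

/-- The substitution `(n ↦ n + d)` under `k` binders. -/
def shiftAt (d k n : ℕ) : Term := if n < k then .var n else .var (n + d)

theorem upSubst_shiftAt (d k : ℕ) : upSubst (shiftAt d k) = shiftAt d (k + 1) := by
  funext n
  cases n with
  | zero => simp [upSubst, shiftAt]
  | succ n =>
    simp only [upSubst, shiftAt, Nat.add_lt_add_iff_right]
    split <;> simp [Term.rename]; omega

theorem Term.rename_add_eq_mapVars (d : ℕ) (a : Term) :
    a.rename (· + d) = a.mapVars (shiftAt d) 0 := by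
  rw [← Term.subst_eq_mapVars (upSubst_shiftAt d), Term.rename_eq_subst]
  rfl

/-- The substitution `inst u` under `k` binders. -/
def instAt (u : Term) (k n : ℕ) : Term :=
  if n < k then .var n else if n = k then u.rename (· + k) else .var (n - 1)

theorem upSubst_instAt (u : Term) (k : ℕ) : upSubst (instAt u k) = instAt u (k + 1) := by
  funext n
  cases n with
  | zero => simp [upSubst, instAt]
  | succ n =>
    simp only [upSubst, instAt, Nat.add_lt_add_iff_right, Nat.add_right_cancel_iff]
    split
    · rfl
    · split
      · rw [Term.rename_rename]; rfl
      · simp only [Term.rename]; congr 1; omega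

theorem Term.subst_inst_eq_mapVars (u a : Term) :
    a.subst (inst u) = a.mapVars (instAt u) 0 := by
  rw [← Term.subst_eq_mapVars (upSubst_instAt u)]
  congr 1
  funext n
  cases n with
  | zero => exact (Term.rename_id u).symm
  | succ n => simp [inst, instAt]

/-- The position of the value at depth `k` and code `c` in a course-of-values table. Going from
a term to a subterm under one more binder decreases it. -/
def tableIndex (k c : ℕ) : ℕ := Nat.pair (k + c) c

theorem tableIndex_lt {k c k' c' : ℕ} (h : k + c < k' + c') (hc : c < c') :
    tableIndex k c < tableIndex k' c' :=
  (Nat.pair_lt_pair_left _ h).trans (Nat.pair_lt_pair_right _ hc)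

/-- Passing under a `lam` raises the depth by one; the drop in the code must outweigh this for the
table index to decrease. -/
theorem lt_pair_of_two_le {t : ℕ} (ht : 2 ≤ t) (q : ℕ) : q + 1 < Nat.pair t q := by
  unfold Nat.pair
  split <;> nlinarith

theorem lt_pair_pos {t : ℕ} (ht : 0 < t) (q : ℕ) : q < Nat.pair t q := by
  unfold Nat.pair
  split <;> nlinarith

/-- One step of the course-of-values recursion for `Term.mapVars` on codes; `look` gives access
to the values at smaller codes. -/
def mapVarsStep (v : ℕ → ℕ → ℕ) (look : ℕ → ℕ → ℕ) (k c : ℕ) : ℕ :=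
  let t := c.unpair.1
  let q := c.unpair.2
  let q₁ := q.unpair.1
  let q₂ := q.unpair.2
  if t = 0 then v k q
  else if t = 1 ∨ t = 7 then Nat.pair t (Nat.pair (look k q₁) (look k q₂))
  else if t = 2 then Nat.pair t (look (k + 1) q)
  else if t = 4 then Nat.pair t (look k q)
  else if t = 5 ∨ t = 8 then
    Nat.pair t (Nat.pair (look k q₁) (Nat.pair (look k q₂.unpair.1) (look k q₂.unpair.2)))
  else c

/-- `Term.mapVars` on codes. -/
def mapVarsCode (v : ℕ → ℕ → ℕ) (n : ℕ) : ℕ :=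
  mapVarsStep v (fun k c => if tableIndex k c < n then mapVarsCode v (tableIndex k c) else 0)
    (n.unpair.1 - n.unpair.2) n.unpair.2
termination_by n

theorem mapVarsCode_tableIndex (v : ℕ → ℕ → ℕ) (k c : ℕ) :
    mapVarsCode v (tableIndex k c) =
      mapVarsStep v (fun k' c' => if tableIndex k' c' < tableIndex k c then
        mapVarsCode v (tableIndex k' c') else 0) k c := by
  rw [mapVarsCode]
  simp [tableIndex]

/-- On genuine codes every recursive call has a smaller table index, so the guard succeeds and the
default value `0` is never used. -/
theorem mapVarsCode_code {v : ℕ → ℕ → Term} {v' : ℕ → ℕ → ℕ} (hv : ∀ k n, v' k n = (v k n).code)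
    (a : Term) : ∀ k, mapVarsCode v' (tableIndex k a.code) = (a.mapVars v k).code := by
  have lt {k c c' : ℕ} (h : c < c') : tableIndex k c < tableIndex k c' :=
    tableIndex_lt (by omega) h
  have pl (a b : ℕ) : a ≤ Nat.pair a b := Nat.left_le_pair a b
  have pr (a b : ℕ) : b ≤ Nat.pair a b := Nat.right_le_pair a b
  have pos {t q x : ℕ} (ht : 0 < t) (h : x ≤ q) : x < Nat.pair t q :=
    h.trans_lt (lt_pair_pos ht q)
  induction a with
  | var n => intro k; rw [mapVarsCode_tableIndex]; simp [mapVarsStep, Term.code, Term.mapVars, hv]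
  | zero | nil | join =>
    intro k; rw [mapVarsCode_tableIndex]; simp [mapVarsStep, Term.code, Term.mapVars]
  | lam a ih =>
    intro k
    have h : tableIndex (k + 1) a.code < tableIndex k (Nat.pair 2 a.code) := by
      have := lt_pair_of_two_le le_rfl a.code
      exact tableIndex_lt (by omega) (by omega)
    rw [mapVarsCode_tableIndex]
    simp [mapVarsStep, Term.code, Term.mapVars, h, ih]
  | succ a ih =>
    intro k
    rw [mapVarsCode_tableIndex]
    simp [mapVarsStep, Term.code, Term.mapVars, lt (pos _ le_rfl), ih]
  | app a b iha ihb | cons a b iha ihb =>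
    intro k
    rw [mapVarsCode_tableIndex]
    simp [mapVarsStep, Term.code, Term.mapVars, lt (pos _ (pl _ _)), lt (pos _ (pr _ _)), iha, ihb]
  | recNat a b c iha ihb ihc | recVec a b c iha ihb ihc =>
    intro k
    rw [mapVarsCode_tableIndex]
    simp [mapVarsStep, Term.code, Term.mapVars, lt (pos _ (pl _ _)), iha, ihb, ihc,
      lt (pos _ ((pl _ _).trans (pr _ _))), lt (pos _ ((pr _ _).trans (pr _ _)))]

theorem primrec_tableIndex : Primrec₂ tableIndex :=
  Primrec₂.natPair.comp (Primrec.nat_add.comp .fst .snd) .snd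

theorem primrec_unpair_fst : Primrec fun n : ℕ => n.unpair.1 := Primrec.fst.comp .unpair

theorem primrec_unpair_snd : Primrec fun n : ℕ => n.unpair.2 := Primrec.snd.comp .unpair

theorem primrecPred_eq_const {α : Type*} [Primcodable α] {f : α → ℕ} (hf : Primrec f) (m : ℕ) :
    PrimrecPred fun x => f x = m :=
  Primrec.eq.comp hf (.const m)

theorem primrec_mapVarsStep {α : Type*} [Primcodable α] {v look : α → ℕ → ℕ → ℕ}
    {k c : α → ℕ} (hv : Primrec fun x : α × ℕ × ℕ => v x.1 x.2.1 x.2.2)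
    (hl : Primrec fun x : α × ℕ × ℕ => look x.1 x.2.1 x.2.2) (hk : Primrec k) (hc : Primrec c) :
    Primrec fun x => mapVarsStep (v x) (look x) (k x) (c x) := by
  have ht := primrec_unpair_fst.comp hc
  have hq := primrec_unpair_snd.comp hc
  have hq₁ := primrec_unpair_fst.comp hq
  have hq₂ := primrec_unpair_snd.comp hq
  have ap {w : α → ℕ → ℕ → ℕ} (hw : Primrec fun x : α × ℕ × ℕ => w x.1 x.2.1 x.2.2)
      {k c : α → ℕ} (hk : Primrec k) (hc : Primrec c) : Primrec fun x => w x (k x) (c x) :=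
    hw.comp (Primrec.id.pair (hk.pair hc))
  have pair {f g : α → ℕ} (hf : Primrec f) (hg : Primrec g) :
      Primrec fun x => Nat.pair (f x) (g x) := Primrec₂.natPair.comp hf hg
  unfold mapVarsStep
  refine .ite (primrecPred_eq_const ht 0) (ap hv hk hq) ?_
  refine .ite ((primrecPred_eq_const ht 1).or (primrecPred_eq_const ht 7))
    (pair ht (pair (ap hl hk hq₁) (ap hl hk hq₂))) ?_
  refine .ite (primrecPred_eq_const ht 2) (pair ht (ap hl (Primrec.succ.comp hk) hq)) ?_
  refine .ite (primrecPred_eq_const ht 4) (pair ht (ap hl hk hq)) ?_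
  exact .ite ((primrecPred_eq_const ht 5).or (primrecPred_eq_const ht 8))
    (pair ht (pair (ap hl hk hq₁) (pair (ap hl hk (primrec_unpair_fst.comp hq₂))
      (ap hl hk (primrec_unpair_snd.comp hq₂))))) hc

theorem getD_map_range (f : ℕ → ℕ) (n i : ℕ) :
    ((List.range n).map f).getD i 0 = if i < n then f i else 0 := by
  split <;> simp_all [List.getD_eq_getElem?_getD]

theorem primrec_mapVarsCode {α : Type*} [Primcodable α] {v : α → ℕ → ℕ → ℕ}
    (hv : Primrec fun x : α × ℕ × ℕ => v x.1 x.2.1 x.2.2) :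
    Primrec₂ fun x n => mapVarsCode (v x) n := by
  have hn : Primrec fun x : α × List ℕ => x.2.length := Primrec.list_length.comp .snd
  have hc := primrec_unpair_snd.comp hn
  -- The length of the table of earlier values is the current index. Reading beyond its end returns
  -- `0`, matching the guard in `mapVarsCode`.
  refine Primrec.nat_strong_rec _ (g := fun x l => some
    (mapVarsStep (v x) (fun k c => l.getD (tableIndex k c) 0)
      (l.length.unpair.1 - l.length.unpair.2) l.length.unpair.2)) ?_ fun x n => ?_
  · refine Primrec.option_some.comp (primrec_mapVarsStep (α := α × List ℕ)
      (v := fun x => v x.1) (look := fun x k c => x.2.getD (tableIndex k c) 0)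
      (hv.comp ((Primrec.fst.comp .fst).pair .snd)) ?_
      (Primrec.nat_sub.comp (primrec_unpair_fst.comp hn) hc) hc)
    exact (Primrec.list_getD 0).comp (Primrec.snd.comp .fst)
      (primrec_tableIndex.comp (Primrec.fst.comp .snd) (Primrec.snd.comp .snd))
  · rw [mapVarsCode]
    simp only [getD_map_range, List.length_map, List.length_range]

/-- `shiftAt` on codes. -/
def shiftAtCode (d k n : ℕ) : ℕ := if n < k then Nat.pair 0 n else Nat.pair 0 (n + d)

theorem shiftAtCode_eq (d k n : ℕ) : shiftAtCode d k n = (shiftAt d k n).code := by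
  unfold shiftAtCode shiftAt; split <;> rfl

/-- `instAt` on codes. -/
def instAtCode (u k n : ℕ) : ℕ :=
  if n < k then Nat.pair 0 n
  else if n = k then mapVarsCode (shiftAtCode k) (tableIndex 0 u) else Nat.pair 0 (n - 1)

theorem instAtCode_eq (u : Term) (k n : ℕ) : instAtCode u.code k n = (instAt u k n).code := by
  unfold instAtCode instAt
  rw [mapVarsCode_code (shiftAtCode_eq k), Term.rename_add_eq_mapVars]
  split
  · rfl
  · split <;> rfl

/-- The substitution `a.subst (inst u)` on codes. -/
def instCode (a u : ℕ) : ℕ := mapVarsCode (instAtCode u) (tableIndex 0 a)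

theorem instCode_code (a u : Term) : instCode a.code u.code = (a.subst (inst u)).code := by
  rw [instCode, mapVarsCode_code (instAtCode_eq u), Term.subst_inst_eq_mapVars]

theorem primrec_shiftAtCode :
    Primrec fun x : ℕ × ℕ × ℕ => shiftAtCode x.1 x.2.1 x.2.2 :=
  have hk : Primrec fun x : ℕ × ℕ × ℕ => x.2.1 := Primrec.fst.comp .snd
  have hn : Primrec fun x : ℕ × ℕ × ℕ => x.2.2 := Primrec.snd.comp .snd
  .ite (Primrec.nat_lt.comp hn hk) (Primrec₂.natPair.comp (.const 0) hn)
    (Primrec₂.natPair.comp (.const 0) (Primrec.nat_add.comp hn .fst))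

theorem primrec_instAtCode :
    Primrec fun x : ℕ × ℕ × ℕ => instAtCode x.1 x.2.1 x.2.2 :=
  have hk : Primrec fun x : ℕ × ℕ × ℕ => x.2.1 := Primrec.fst.comp .snd
  have hn : Primrec fun x : ℕ × ℕ × ℕ => x.2.2 := Primrec.snd.comp .snd
  .ite (Primrec.nat_lt.comp hn hk) (Primrec₂.natPair.comp (.const 0) hn) <|
    .ite (Primrec.eq.comp hn hk)
      ((primrec_mapVarsCode primrec_shiftAtCode).comp hk
        (primrec_tableIndex.comp (.const 0) .fst))
      (Primrec₂.natPair.comp (.const 0) (Primrec.pred.comp hn))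

theorem primrec_instCode : Primrec₂ instCode :=
  (primrec_mapVarsCode primrec_instAtCode).comp .snd (primrec_tableIndex.comp (.const 0) .fst)

-- Complete development on codes.

/-- One step of the course-of-values recursion for `Term.dev` on codes. -/
def devStep (look : ℕ → ℕ) (n : ℕ) : ℕ :=
  let t := n.unpair.1
  let q := n.unpair.2
  let q₁ := q.unpair.1
  let q₂ := q.unpair.2
  let b := q₂.unpair.1
  let c := q₂.unpair.2
  let s := c.unpair.1
  let r := Nat.pair t (Nat.pair (look q₁) (Nat.pair (look b) (look c)))
  if t = 1 then
    if q₁.unpair.1 = 2 then instCode (look q₁.unpair.2) (look q₂)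
    else Nat.pair t (Nat.pair (look q₁) (look q₂))
  else if t = 7 then Nat.pair t (Nat.pair (look q₁) (look q₂))
  else if t = 2 ∨ t = 4 then Nat.pair t (look q)
  else if t = 5 then
    if s = 3 then look q₁
    else if s = 4 then
      Nat.pair 1 (Nat.pair (Nat.pair 1 (Nat.pair (look b) (look c.unpair.2)))
        (Nat.pair t (Nat.pair (look q₁) (Nat.pair (look b) (look c.unpair.2)))))
    else r
  else if t = 8 then
    if s = 6 then look q₁
    else if s = 7 then
      Nat.pair 1 (Nat.pair (Nat.pair 1 (Nat.pair (Nat.pair 1 (Nat.pair (look b)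
        (look c.unpair.2.unpair.1))) (look c.unpair.2.unpair.2)))
        (Nat.pair t (Nat.pair (look q₁) (Nat.pair (look b) (look c.unpair.2.unpair.2)))))
    else r
  else n

/-- `Term.dev` on codes. -/
def devCode (n : ℕ) : ℕ := devStep (fun c => if c < n then devCode c else 0) n
termination_by n

theorem primrec_devStep {α : Type*} [Primcodable α] {look : α → ℕ → ℕ} {n : α → ℕ}
    (hl : Primrec₂ look) (hn : Primrec n) : Primrec fun x => devStep (look x) (n x) := by
  have fst {f : α → ℕ} (hf : Primrec f) : Primrec fun x => (f x).unpair.1 :=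
    primrec_unpair_fst.comp hf
  have snd {f : α → ℕ} (hf : Primrec f) : Primrec fun x => (f x).unpair.2 :=
    primrec_unpair_snd.comp hf
  have ap {f : α → ℕ} (hf : Primrec f) : Primrec fun x => look x (f x) := hl.comp .id hf
  have pair {f g : α → ℕ} (hf : Primrec f) (hg : Primrec g) :
      Primrec fun x => Nat.pair (f x) (g x) := Primrec₂.natPair.comp hf hg
  have one : Primrec fun _ : α => 1 := .const 1
  have ht := fst hn
  have hq := snd hn
  have hq₁ := fst hq
  have hq₂ := snd hq
  have hb := fst hq₂
  have hc := snd hq₂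
  have hs := fst hc
  have hd := snd hc
  have hr := pair ht (pair (ap hq₁) (pair (ap hb) (ap hc)))
  unfold devStep
  refine .ite (primrecPred_eq_const ht 1) (.ite (primrecPred_eq_const (fst hq₁) 2)
    (primrec_instCode.comp (ap (snd hq₁)) (ap hq₂)) (pair ht (pair (ap hq₁) (ap hq₂)))) ?_
  refine .ite (primrecPred_eq_const ht 7) (pair ht (pair (ap hq₁) (ap hq₂))) ?_
  refine .ite ((primrecPred_eq_const ht 2).or (primrecPred_eq_const ht 4)) (pair ht (ap hq)) ?_
  refine .ite (primrecPred_eq_const ht 5) (.ite (primrecPred_eq_const hs 3) (ap hq₁) <|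
    .ite (primrecPred_eq_const hs 4) (pair one (pair (pair one (pair (ap hb) (ap hd)))
      (pair ht (pair (ap hq₁) (pair (ap hb) (ap hd)))))) hr) ?_
  exact .ite (primrecPred_eq_const ht 8) (.ite (primrecPred_eq_const hs 6) (ap hq₁) <|
    .ite (primrecPred_eq_const hs 7) (pair one (pair (pair one (pair (pair one (pair (ap hb)
      (ap (fst hd)))) (ap (snd hd)))) (pair ht (pair (ap hq₁) (pair (ap hb) (ap (snd hd))))))) hr) hn

theorem primrec_devCode : Primrec devCode := by
  refine (Primrec.nat_strong_rec (fun _ : Unit => devCode) (g := fun _ l => some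
    (devStep (fun c => l.getD c 0) l.length)) ?_ fun _ n => ?_).comp (.const ()) .id
  · exact Primrec.option_some.comp (primrec_devStep (α := Unit × List ℕ)
      (look := fun x c => x.2.getD c 0)
      ((Primrec.list_getD 0).comp (Primrec.snd.comp .fst) .snd) (Primrec.list_length.comp .snd))
  · rw [devCode]
    simp only [getD_map_range, List.length_map, List.length_range]

/-- This and the next two lemmas turn the fall-through cases in the definition of `Term.dev` into
the failure of the tag tests in `devStep`. -/
theorem Term.code_tag_ne_lam {a : Term} (h : ∀ b, a ≠ .lam b) : a.code.unpair.1 ≠ 2 := by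
  cases a <;> simp_all [Term.code]

theorem Term.code_tag_ne_nat {a : Term} (h₀ : a ≠ .zero) (h : ∀ b, a ≠ .succ b) :
    a.code.unpair.1 ≠ 3 ∧ a.code.unpair.1 ≠ 4 := by
  cases a <;> simp_all [Term.code]

theorem Term.code_tag_ne_vec {a : Term} (h₀ : a ≠ .nil) (h : ∀ b c, a ≠ .cons b c) :
    a.code.unpair.1 ≠ 6 ∧ a.code.unpair.1 ≠ 7 := by
  cases a <;> simp_all [Term.code]

theorem devCode_code (a : Term) : devCode a.code = a.dev.code := by
  have pl {x a : ℕ} (b : ℕ) (h : x ≤ a) : x ≤ Nat.pair a b := h.trans (Nat.left_le_pair a b)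
  have pr {x b : ℕ} (a : ℕ) (h : x ≤ b) : x ≤ Nat.pair a b := h.trans (Nat.right_le_pair a b)
  have pos {t q x : ℕ} (ht : 0 < t) (h : x ≤ q) : x < Nat.pair t q :=
    h.trans_lt (lt_pair_pos ht q)
  induction a using Term.dev.induct
  case case2 a b _ _ =>
    have : a.code < Nat.pair 1 (Nat.pair (Nat.pair 2 a.code) b.code) :=
      pos one_pos (pl _ (pr _ le_rfl))
    rw [devCode]
    simp_all (maxDischargeDepth := 8) [devStep, Term.code, Term.dev, instCode_code]
  case case3 a b h _ _ =>
    have := Term.code_tag_ne_lam h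
    rw [devCode]
    simp_all (maxDischargeDepth := 8) [devStep, Term.code, Term.dev]
  case case9 a b c h₀ h _ _ _ =>
    have := Term.code_tag_ne_nat h₀ h
    rw [devCode]
    simp_all (maxDischargeDepth := 8) [devStep, Term.code, Term.dev]
  case case14 a b c h₀ h _ _ _ =>
    have := Term.code_tag_ne_vec h₀ h
    rw [devCode]
    simp_all (maxDischargeDepth := 8) [devStep, Term.code, Term.dev]
  all_goals
    rw [devCode]
    simp_all (maxDischargeDepth := 8) [devStep, Term.code, Term.dev]

-- The decision procedure.

/-- Decides joinability of terms with normal forms by iterating complete developments. -/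
def joinableDec (x y : ℕ) : Part Bool :=
  (Nat.rfind fun k => Part.some (decide
    (devCode (devCode^[k] x) = devCode^[k] x ∧ devCode (devCode^[k] y) = devCode^[k] y))).map
      fun k => decide (devCode^[k] x = devCode^[k] y)

theorem partrec_joinableDec : Partrec₂ joinableDec := by
  have it {f : (ℕ × ℕ) × ℕ → ℕ} (hf : Primrec f) :
      Primrec fun x : (ℕ × ℕ) × ℕ => devCode^[x.2] (f x) :=
    Primrec.nat_iterate .snd hf (primrec_devCode.comp .snd).to₂
  have hx := it (Primrec.fst.comp .fst)
  have hy := it (Primrec.snd.comp .fst)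
  refine Partrec.map (Partrec.rfind ?_) (Primrec.eq.comp hx hy).decide.to_comp
  exact Computable.partrec ((Primrec.eq.comp (primrec_devCode.comp hx) hx).and
    (Primrec.eq.comp (primrec_devCode.comp hy) hy)).decide.to_comp

theorem iterate_devCode_code (k : ℕ) (a : Term) :
    devCode^[k] a.code = (Term.dev^[k] a).code := by
  induction k with
  | zero => rfl
  | succ k ih => simp only [Function.iterate_succ_apply', ih, devCode_code]

theorem joinableDec_spec {a b : Term} (ha : Normalizing a) (hb : Normalizing b) :
    ∃ r : Bool, r ∈ joinableDec a.code b.code ∧ (r = true ↔ Joinable a b) := by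
  obtain ⟨n, han, hn⟩ := id ha
  obtain ⟨m, hbm, hm⟩ := id hb
  obtain ⟨i, rfl⟩ := han.exists_iterate_dev_eq hn
  obtain ⟨j, rfl⟩ := hbm.exists_iterate_dev_eq hm
  have hdom : ((Nat.rfind fun k => Part.some (decide
      (devCode (devCode^[k] a.code) = devCode^[k] a.code ∧
        devCode (devCode^[k] b.code) = devCode^[k] b.code)) : Part ℕ)).Dom := by
    -- By stage `i + j` both orbits have reached their normal forms and are stationary.
    refine Nat.rfind_dom.2 ⟨i + j, ?_, fun _ => trivial⟩
    have hi : Term.dev^[i + j] a = Term.dev^[i] a := by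
      rw [add_comm, Function.iterate_add_apply, hn.iterate_dev]
    have hj : Term.dev^[i + j] b = Term.dev^[j] b := by
      rw [Function.iterate_add_apply, hm.iterate_dev]
    simp only [iterate_devCode_code, devCode_code, hi, hj, Part.mem_some_iff]
    have h₁ := hn.iterate_dev 1
    have h₂ := hm.iterate_dev 1
    simp only [Function.iterate_one] at h₁ h₂
    simp [h₁, h₂]
  obtain ⟨k, hk⟩ := Part.dom_iff_mem.1 hdom
  refine ⟨_, Part.mem_map _ hk, ?_⟩
  have hfix := Nat.rfind_spec hk
  simp only [iterate_devCode_code, devCode_code, Part.mem_some_iff, Term.code_injective.eq_iff,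
    eq_comm (a := true), decide_eq_true_eq] at hfix ⊢
  -- The search may stop at a stage other than `i + j`; normalization of both terms guarantees that
  -- the fixed points found there are the normal forms.
  exact (joinable_iff_eq (a.steps_iterate_dev k) (ha.nf_of_isFixedPt hfix.1)
    (b.steps_iterate_dev k) (hb.nf_of_isFixedPt hfix.2)).symm

end Tvec

theorem mainTheorem7 :
    ∃ dec : ℕ → ℕ →. Bool, Partrec₂ dec ∧
      ∀ (Γ : Tvec.Ctx) (a a' : Tvec.Term) (A A' : Tvec.Ty),
        Tvec.HasType Γ a A → Tvec.HasType Γ a' A' →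
          ∃ r : Bool, r ∈ dec a.code a'.code ∧ (r = true ↔ Tvec.Joinable a a') :=
  ⟨Tvec.joinableDec, Tvec.partrec_joinableDec, fun _ _ _ _ _ ha ha' =>
    Tvec.joinableDec_spec ha.normalizing ha'.normalizing⟩
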